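/- Conventions. All arithmetic is in $[0,\infty]$, with $b\ominus a=\max\{b-a,0\}$, $\infty\ominus\infty=0$, and $\infty\ominus a=\infty$ for $a<\infty$; $\inf\varnothing=\infty$ and $\sup\varnothing=0$. An approach space is a set $X$ with a map $\delta:X\times 2^X\to[0,\infty]$ such that, for all $x\in X$ and $A,B\subseteq X$: $\delta(x,\{x\})=0$; $\delta(x,\varnothing)=\infty$; $\delta(x,A\cup B)=\min\{\delta(x,A),\delta(x,B)\}$; $\delta(x,A)\le\delta(x,B)+\sup_{b\in B}\delta(b,A)$. It is $T_0$ if $\delta(x,\{y\})=\delta(y,\{x\})=0$ implies $x=y$. A contraction $f:(X,\delta_X)\to(Y,\delta_Y)$ is a map with $\delta_Y(f(x),f(A))\le\delta_X(x,A)$ for all $x\in X$, $A\subseteq X$; it is an embedding if equality always holds. A $T_0$ approach space $Z$ is injective if for every embedding $e:X\to Y$ of approach spaces and every contraction $f:X\to Z$ there is a contraction $f^*:Y\to Z$ with $f^*\circ e=f$. A metric space is a set $X$ with a map $d:X\times X\to[0,\infty]$ such that $d(x,x)=0$ and $d(x,z)\le d(x,y)+d(y,z)$ for all $x,y,z\in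 X$; it is separated if $d(x,y)=d(y,x)=0$ implies $x=y$. A weight of $(X,d)$ is a function $\phi:X\to[0,\infty]$ with $\phi(x)\le\phi(y)+d(x,y)$ for all $x,y$; a coweight is a function $\psi:X\to[0,\infty]$ with $\psi(y)\le\psi(x)+d(x,y)$ for all $x,y$. For weights $\phi,\psi$ put $\overline d(\phi,\psi)=\sup_{x\in X}(\psi(x)\ominus\phi(x))$. A colimit of a weight $\phi$ is a point $a\in X$ with $\overline d(\phi,d(-,y))=d(a,y)$ for all $y\in X$. The space $(X,d)$ is cocomplete if every weight of it has a colimit. A net $\{x_i\}_i$ (indexed by a non-empty directed preordered set) in $(X,d)$ is forward Cauchy if $\inf_i\sup_{k\ge j\ge i}d(x_j,x_k)=0$; a point $x$ is a Yoneda limit of such a net if $d(x,y)=\inf_i\sup_{j\ge i}d(x_j,y)$ for all $y\in X$; and $(X,d)$ is Yoneda complete if every forward Cauchy net in it has a Yoneda limit. A weight $\phi$ is flat if $\inf_{x}\phi(x)=0$ and $\phi\otimes\max\{\psi_1,\psi_2\}=\max\{\phi\otimes\psi_1,\phi\otimes\psi_2\}$ for all coweights $\psi_1,\psi_2$, where $\phi\otimes\psi=\inf_{x\in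 X}(\phi(x)+\psi(x))$. Let $\mathcal FX$ be the set of flat weights with the metric $\overline d$, and let $\mathbf y:X\to\mathcal FX$, $\mathbf y(x)=d(-,x)$. A map $f$ between metric spaces $(X,d_X)$ and $(Y,d_Y)$ is non-expansive if $d_Y(f(x),f(x'))\le d_X(x,x')$ for all $x,x'$; non-expansive maps $f:X\to Y$ and $g:Y\to X$ are adjoint, $f$ being left adjoint to $g$, if $d_Y(f(x),y)=d_X(x,g(y))$ for all $x,y$. The space $(X,d)$ is continuous if it is Yoneda complete and the left adjoint $\mathrm{colim}:\mathcal FX\to X$ of $\mathbf y$ itself has a left adjoint $X\to\mathcal FX$. A Scott weight of $(X,d)$ is a weight $\phi$ such that $\phi(x)\le\inf_i\sup_{j\ge i}\phi(x_j)$ for every forward Cauchy net $\{x_i\}_i$ in $(X,d)$ and every Yoneda limit $x$ of it. The Scott distance space $\Sigma(X,d)$ is $X$ with the approach distance $\sigma(x,A)=\sup\{\phi(x)\mid\phi\text{ a Scott weight with }\phi(a)=0\text{ for all }a\in A\}$. The specialization metric space $\Omega(X,\delta)$ of an approach space is $X$ with the metric $(x,y)\mapsto\delta(x,\{y\})$.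 Theorem. Let $(X,\delta)$ be an injective $T_0$ approach space. Then $\Omega(X,\delta)$ is a separated metric space that is cocomplete and continuous, and $(X,\delta)=\Sigma\Omega(X,\delta)$, that is, $\delta$ is the Scott distance of the metric space $\Omega(X,\delta)$. -/

import Mathlib

open scoped ENNReal

universe u v

/-- A metric in the sense of Lawvere: a map `d : X × X → [0, ∞]` with `d x x = 0` and the
triangle inequality. No symmetry, separation or finiteness is required. -/
@[ext]
structure LawvereMetric (X : Type u) where
  dist : X → X → ℝ≥0∞
  dist_self : ∀ x, dist x x = 0
  triangle : ∀ x y z, dist x z ≤ dist x y + dist y z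

/-- An approach distance on `X`: a point-to-set distance with values in `[0, ∞]`. -/
@[ext]
structure ApproachDistance (X : Type u) where
  dist : X → Set X → ℝ≥0∞
  dist_singleton : ∀ x, dist x {x} = 0
  dist_empty : ∀ x, dist x ∅ = ∞
  dist_union : ∀ x A B, dist x (A ∪ B) = min (dist x A) (dist x B)
  triangle : ∀ x A B, dist x A ≤ dist x B + ⨆ b ∈ B, dist b A

namespace ApproachDistance

variable {X : Type u} {Y : Type v}

/-- Contractions between approach spaces. -/
def IsContraction (δX : ApproachDistance X) (δY : ApproachDistance Y) (f : X → Y) : Prop :=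
  ∀ (x : X) (A : Set X), δY.dist (f x) (f '' A) ≤ δX.dist x A

/-- Embeddings of approach spaces: contractions that preserve the distance. -/
def IsEmbedding (δX : ApproachDistance X) (δY : ApproachDistance Y) (e : X → Y) : Prop :=
  IsContraction δX δY e ∧ ∀ (x : X) (A : Set X), δX.dist x A = δY.dist (e x) (e '' A)

/-- `T₀` approach spaces. -/
def IsT0 (δ : ApproachDistance X) : Prop :=
  ∀ x y : X, δ.dist x {y} = 0 → δ.dist y {x} = 0 → x = y

/-- Injective approach spaces: contractions into the space extend along embeddings. -/
def IsInjective {Z : Type u} (δZ : ApproachDistance Z) : Prop :=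
  ∀ (X Y : Type u) (δX : ApproachDistance X) (δY : ApproachDistance Y) (e : X → Y) (f : X → Z),
    IsEmbedding δX δY e → IsContraction δX δZ f →
      ∃ g : Y → Z, IsContraction δY δZ g ∧ f = g ∘ e

/-- The specialization metric `Ω(δ)(x, y) = δ(x, {y})`. -/
def specializationMetric (δ : ApproachDistance X) : LawvereMetric X where
  dist x y := δ.dist x {y}
  dist_self := δ.dist_singleton
  triangle x y z := by simpa using δ.triangle x {z} {y}

end ApproachDistance

namespace LawvereMetric

variable {X : Type u} {Y : Type v}

/-- A separated metric space. -/
def IsSeparated (d : LawvereMetric X) : Prop :=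
  ∀ x y : X, d.dist x y = 0 → d.dist y x = 0 → x = y

/-- Non-expansive maps. -/
def IsNonexpansive (dX : LawvereMetric X) (dY : LawvereMetric Y) (f : X → Y) : Prop :=
  ∀ x y : X, dY.dist (f x) (f y) ≤ dX.dist x y

/-- `f` is left adjoint to `g`. -/
def IsAdjoint (dX : LawvereMetric X) (dY : LawvereMetric Y) (f : X → Y) (g : Y → X) : Prop :=
  IsNonexpansive dX dY f ∧ IsNonexpansive dY dX g ∧
    ∀ (x : X) (y : Y), dY.dist (f x) y = dX.dist x (g y)

/-- A net is forward Cauchy if `inf_i sup_{k ≥ j ≥ i} d(x_j, x_k) = 0`. -/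
def IsForwardCauchy (d : LawvereMetric X) {I : Type v} [Preorder I] (x : I → X) : Prop :=
  (⨅ i : I, ⨆ j : I, ⨆ _ : i ≤ j, ⨆ k : I, ⨆ _ : j ≤ k, d.dist (x j) (x k)) = 0

/-- The defining equation of a Yoneda limit `a` of a net; it is only used for nets that
are forward Cauchy. -/
def IsYonedaLimit (d : LawvereMetric X) {I : Type v} [Preorder I] (x : I → X) (a : X) : Prop :=
  ∀ y : X, d.dist a y = ⨅ i : I, ⨆ j : I, ⨆ _ : i ≤ j, d.dist (x j) y

/-- Every forward Cauchy net, indexed by a nonempty directed preordered set, has a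
Yoneda limit. -/
def IsYonedaComplete (d : LawvereMetric X) : Prop :=
  ∀ (I : Type u) [Preorder I] [Nonempty I] [IsDirectedOrder I] (x : I → X),
    d.IsForwardCauchy x → ∃ a : X, d.IsYonedaLimit x a

/-- Weights of a metric space. -/
def IsWeight (d : LawvereMetric X) (φ : X → ℝ≥0∞) : Prop :=
  ∀ x y : X, φ x ≤ φ y + d.dist x y

/-- Coweights of a metric space. -/
def IsCoweight (d : LawvereMetric X) (ψ : X → ℝ≥0∞) : Prop :=
  ∀ x y : X, ψ y ≤ ψ x + d.dist x y

/-- Scott weights. -/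
def IsScottWeight (d : LawvereMetric X) (φ : X → ℝ≥0∞) : Prop :=
  d.IsWeight φ ∧
    ∀ (I : Type u) [Preorder I] [Nonempty I] [IsDirectedOrder I] (x : I → X) (a : X),
      d.IsForwardCauchy x → d.IsYonedaLimit x a →
        φ a ≤ ⨅ i : I, ⨆ j : I, ⨆ _ : i ≤ j, φ (x j)

/-- The distance `sup_x (ψ x ⊖ φ x)` from `φ` to `ψ`; truncated subtraction on `[0, ∞]`
satisfies `∞ - ∞ = 0` and `∞ - a = ∞` for `a < ∞`. -/
noncomputable def weightDist (φ ψ : X → ℝ≥0∞) : ℝ≥0∞ := ⨆ x : X, (ψ x - φ x)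

/-- The tensor product of a weight and a coweight. -/
noncomputable def tensor (φ ψ : X → ℝ≥0∞) : ℝ≥0∞ := ⨅ x : X, (φ x + ψ x)

/-- `a` is a colimit of the weight `φ`. -/
def IsColimit (d : LawvereMetric X) (φ : X → ℝ≥0∞) (a : X) : Prop :=
  ∀ y : X, weightDist φ (fun x => d.dist x y) = d.dist a y

/-- A metric space is cocomplete if each of its weights has a colimit. -/
def IsCocomplete (d : LawvereMetric X) : Prop :=
  ∀ φ : X → ℝ≥0∞, d.IsWeight φ → ∃ a : X, d.IsColimit φ a

/-- Flat weights. -/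
def IsFlat (d : LawvereMetric X) (φ : X → ℝ≥0∞) : Prop :=
  d.IsWeight φ ∧ (⨅ x : X, φ x) = 0 ∧
    ∀ ψ₁ ψ₂ : X → ℝ≥0∞, d.IsCoweight ψ₁ → d.IsCoweight ψ₂ →
      tensor φ (fun x => max (ψ₁ x) (ψ₂ x)) = max (tensor φ ψ₁) (tensor φ ψ₂)

/-- The set of flat weights of a metric space. -/
def FlatWeight (d : LawvereMetric X) : Type u := {φ : X → ℝ≥0∞ // d.IsFlat φ}

/-- The metric on the set of flat weights. -/
noncomputable def flatMetric (d : LawvereMetric X) : LawvereMetric d.FlatWeight where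
  dist φ ψ := weightDist φ.1 ψ.1
  dist_self φ := by simp [weightDist]
  triangle φ ψ χ := by
    refine iSup_le fun x => ?_
    have h1 : ψ.1 x - φ.1 x ≤ weightDist φ.1 ψ.1 := le_iSup (fun x => ψ.1 x - φ.1 x) x
    have h2 : χ.1 x - ψ.1 x ≤ weightDist ψ.1 χ.1 := le_iSup (fun x => χ.1 x - ψ.1 x) x
    rw [add_comm]
    exact tsub_le_tsub_add_tsub.trans (add_le_add h2 h1)

theorem tensor_representable (d : LawvereMetric X) (x : X) {ψ : X → ℝ≥0∞}
    (hψ : d.IsCoweight ψ) : tensor (fun z => d.dist z x) ψ = ψ x := by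
  refine le_antisymm ((iInf_le _ x).trans_eq (by simp [d.dist_self])) (le_iInf fun z => ?_)
  rw [add_comm]
  exact hψ z x

theorem isFlat_representable (d : LawvereMetric X) (x : X) :
    d.IsFlat (fun z => d.dist z x) := by
  refine ⟨fun y z => ?_, ?_, fun ψ₁ ψ₂ h₁ h₂ => ?_⟩
  · rw [add_comm]
    exact d.triangle y z x
  · exact le_antisymm ((iInf_le _ x).trans_eq (d.dist_self x)) bot_le
  · rw [tensor_representable d x h₁, tensor_representable d x h₂, tensor_representable d x]
    intro y z
    exact max_le ((h₁ y z).trans (add_le_add_left (le_max_left _ _) _))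
      ((h₂ y z).trans (add_le_add_left (le_max_right _ _) _))

/-- The Yoneda embedding `x ↦ d(-, x)` into the space of flat weights. -/
def yoneda (d : LawvereMetric X) (x : X) : d.FlatWeight :=
  ⟨fun z => d.dist z x, d.isFlat_representable x⟩

/-- A metric space is continuous if it is Yoneda complete and the left adjoint `colim` of the
Yoneda embedding into the space of flat weights has a left adjoint. -/
def IsContinuous (d : LawvereMetric X) : Prop :=
  d.IsYonedaComplete ∧
    ∃ colim : d.FlatWeight → X, IsAdjoint d.flatMetric d colim d.yoneda ∧
      ∃ wayBelow : X → d.FlatWeight, IsAdjoint d d.flatMetric wayBelow colim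

theorem IsScottWeight.inf_weight {d : LawvereMetric X} {φ ψ : X → ℝ≥0∞} (hφ : d.IsScottWeight φ)
    (hψ : d.IsScottWeight ψ) : d.IsScottWeight (fun x => min (φ x) (ψ x)) := by
  refine ⟨fun x y => ?_, ?_⟩
  · rw [min_add]
    exact min_le_min (hφ.1 x y) (hψ.1 x y)
  intro I _ _ _ x a hx ha
  -- along a forward Cauchy net, frequent upper bounds of a weight are eventual ones
  have key : ∀ χ : X → ℝ≥0∞, d.IsScottWeight χ → ∀ c : ℝ≥0∞,
      (∀ i : I, ∃ j, i ≤ j ∧ χ (x j) ≤ c) → χ a ≤ c := by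
    intro χ hχ c hc
    refine (hχ.2 I x a hx ha).trans ?_
    refine ENNReal.le_of_forall_pos_le_add fun ε hε _ => ?_
    have hlt : ⨅ i : I, ⨆ j : I, ⨆ _ : i ≤ j, ⨆ k : I, ⨆ _ : j ≤ k, d.dist (x j) (x k)
        < (ε : ℝ≥0∞) := by
      rw [show _ = (0 : ℝ≥0∞) from hx]
      exact_mod_cast hε
    obtain ⟨i, hi⟩ := iInf_lt_iff.1 hlt
    refine (iInf_le _ i).trans (iSup₂_le fun j hj => ?_)
    obtain ⟨k, hjk, hk⟩ := hc j
    refine (hχ.1 (x j) (x k)).trans (add_le_add hk (le_trans ?_ hi.le))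
    exact le_iSup₂_of_le j hj
      (le_iSup₂ (f := fun k (_ : j ≤ k) => d.dist (x j) (x k)) k hjk)
  refine le_iInf fun i => ?_
  set c := ⨆ j : I, ⨆ _ : i ≤ j, min (φ (x j)) (ψ (x j)) with hc
  have hj : ∀ j, i ≤ j → φ (x j) ≤ c ∨ ψ (x j) ≤ c := fun j hj =>
    min_le_iff.1 (le_iSup₂ (f := fun j (_ : i ≤ j) => min (φ (x j)) (ψ (x j))) j hj)
  by_cases h : ∀ i' : I, ∃ j, i' ≤ j ∧ φ (x j) ≤ c
  · exact (min_le_left _ _).trans (key φ hφ c h)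
  · push Not at h
    obtain ⟨i₀, hi₀⟩ := h
    refine (min_le_right _ _).trans (key ψ hψ c fun i' => ?_)
    obtain ⟨m, hm, hm'⟩ := exists_ge_ge i i₀
    obtain ⟨n, hn, hn'⟩ := exists_ge_ge m i'
    exact ⟨n, hn', (hj n (hm.trans hn)).resolve_left (hi₀ n (hm'.trans hn)).not_ge⟩

theorem IsScottWeight.tsub_const {d : LawvereMetric X} {φ : X → ℝ≥0∞} (hφ : d.IsScottWeight φ)
    (r : ℝ≥0∞) : d.IsScottWeight (fun x => φ x - r) := by
  refine ⟨fun x y => ?_, ?_⟩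
  · rw [tsub_le_iff_right, add_right_comm]
    exact (hφ.1 x y).trans (add_le_add_left le_tsub_add _)
  · intro I _ _ _ x a hx ha
    refine le_iInf fun i => tsub_le_iff_right.2 ((hφ.2 I x a hx ha).trans ((iInf_le _ i).trans ?_))
    refine iSup₂_le fun j hj => tsub_le_iff_right.1 ?_
    exact le_iSup₂ (f := fun j (_ : i ≤ j) => φ (x j) - r) j hj

theorem isScottWeight_top (d : LawvereMetric X) : d.IsScottWeight (fun _ => ∞) := by
  refine ⟨fun _ _ => by simp, fun I _ _ _ x a _ _ => le_iInf fun i => ?_⟩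
  exact le_iSup₂ (f := fun j (_ : i ≤ j) => ∞) i le_rfl

/-- The Scott distance of a metric space:
`σ(x, A) = sup {φ(x) | φ a Scott weight that vanishes on A}`. -/
noncomputable def scottDistance (d : LawvereMetric X) : ApproachDistance X where
  dist x A := ⨆ φ : X → ℝ≥0∞, ⨆ _ : d.IsScottWeight φ ∧ ∀ a ∈ A, φ a = 0, φ x
  dist_singleton x := by simp +contextual
  dist_empty x := top_le_iff.1 <|
    le_iSup₂_of_le
      (fun _ => ∞) ⟨d.isScottWeight_top, by simp⟩ le_rfl
  dist_union x A B := by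
    refine le_antisymm (le_min ?_ ?_) ?_
    · exact iSup₂_le fun φ hφ => le_iSup₂_of_le φ ⟨hφ.1, fun a ha => hφ.2 a (Or.inl ha)⟩ le_rfl
    · exact iSup₂_le fun φ hφ => le_iSup₂_of_le φ ⟨hφ.1, fun a ha => hφ.2 a (Or.inr ha)⟩ le_rfl
    · refine le_of_forall_lt fun c hc => ?_
      obtain ⟨hA, hB⟩ := lt_min_iff.1 hc
      obtain ⟨φ, hφ⟩ := lt_iSup_iff.1 hA
      obtain ⟨hφ', hφc⟩ := lt_iSup_iff.1 hφ
      obtain ⟨ψ, hψ⟩ := lt_iSup_iff.1 hB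
      obtain ⟨hψ', hψc⟩ := lt_iSup_iff.1 hψ
      refine (lt_min hφc hψc).trans_le (le_iSup₂_of_le (fun x => min (φ x) (ψ x))
        ⟨hφ'.1.inf_weight hψ'.1, ?_⟩ le_rfl)
      rintro a (ha | ha)
      · simp [hφ'.2 a ha]
      · simp [hψ'.2 a ha]
  triangle x A B := by
    refine iSup₂_le fun φ hφ => ?_
    refine tsub_le_iff_right.1 (le_iSup₂_of_le (fun x => φ x -
      ⨆ b ∈ B, ⨆ φ : X → ℝ≥0∞, ⨆ _ : d.IsScottWeight φ ∧ ∀ a ∈ A, φ a = 0, φ b)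
      ⟨hφ.1.tsub_const _, fun b hb => tsub_eq_zero_of_le ?_⟩ le_rfl)
    exact le_iSup₂_of_le b hb (le_iSup₂_of_le φ hφ le_rfl)

end LawvereMetric

/-! ### Weights, tensors and flatness -/

namespace LawvereMetric

open Filter

variable {X : Type u} {Y : Type v}

/-! The map `x ↦ δ(x, -)` embeds `X` in the cube `[0, ∞]^(2^X)`, and injectivity extends the
identity of `X` to a contraction `r` from the cube, so `X` is a retract of it. In the cube, the
finitary points play the role of compact elements: every point is the directed supremum of those
below it, and the cube distance is computed from them.

The main estimate is `φ (r b) ≤ d(b, c)` for `φ` flat, `c` its coordinatewise colimit and `b`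
finitary (`IsFlat.le_dist_cubeColim`, `retract_le_dist_cubeColim`). It holds because `d(b, -)` is a
finite supremum of coweights `t ⊖ z i` with `t` finite, and flat weights preserve finite suprema.

Colimits in `X` are images under `r` of coordinatewise colimits, and Yoneda limits are colimits of
flat net weights. The way-below weight of `x` comes from the net of the `r b`, with `b` finitary
below the image of `x`. By the estimate, `δ(-, A)` respects flat colimits, hence is a Scott weight,
and so `δ ≤ σ`. Conversely, a Scott weight is controlled by its values at the points `r b`, which
gives `σ ≤ δ`. Separation is `T₀` itself. -/

theorem weightDist_le_iff {φ ψ : X → ℝ≥0∞} {c : ℝ≥0∞} :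
    weightDist φ ψ ≤ c ↔ ∀ x, ψ x ≤ φ x + c := by
  simp only [weightDist, iSup_le_iff, tsub_le_iff_left]

theorem le_add_weightDist (φ ψ : X → ℝ≥0∞) (x : X) : ψ x ≤ φ x + weightDist φ ψ :=
  weightDist_le_iff.1 le_rfl x

theorem isCoweight_const (d : LawvereMetric X) (c : ℝ≥0∞) : d.IsCoweight (fun _ => c) :=
  fun _ _ => le_self_add

theorem isWeight_dist (d : LawvereMetric X) (x : X) : d.IsWeight (fun z => d.dist z x) :=
  (d.isFlat_representable x).1

/-- A weight is determined by its tensor products with the representable coweights. -/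
theorem tensor_dist (d : LawvereMetric X) {φ : X → ℝ≥0∞} (hφ : d.IsWeight φ) (x : X) :
    tensor φ (d.dist x) = φ x := by
  refine le_antisymm ((iInf_le _ x).trans_eq (by simp [d.dist_self])) (le_iInf fun z => hφ x z)

theorem IsFlat.tensor_const {d : LawvereMetric X} {φ : X → ℝ≥0∞} (hφ : d.IsFlat φ)
    (c : ℝ≥0∞) : tensor φ (fun _ => c) = c := by
  rw [tensor, ← ENNReal.iInf_add, hφ.2.1, zero_add]

theorem tensor_mono (φ : X → ℝ≥0∞) {ψ₁ ψ₂ : X → ℝ≥0∞} (h : ∀ x, ψ₁ x ≤ ψ₂ x) :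
    tensor φ ψ₁ ≤ tensor φ ψ₂ :=
  iInf_mono fun x => add_le_add_right (h x) _

theorem IsCoweight.sup {d : LawvereMetric X} {ψ₁ ψ₂ : X → ℝ≥0∞} (h₁ : d.IsCoweight ψ₁)
    (h₂ : d.IsCoweight ψ₂) : d.IsCoweight (fun x => max (ψ₁ x) (ψ₂ x)) := fun y z =>
  max_le ((h₁ y z).trans (add_le_add_left (le_max_left _ _) _))
      ((h₂ y z).trans (add_le_add_left (le_max_right _ _) _))

theorem isCoweight_finset_sup {d : LawvereMetric X} {ι : Type*} (F : Finset ι)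
    {ψ : ι → X → ℝ≥0∞} (h : ∀ i, d.IsCoweight (ψ i)) :
    d.IsCoweight (fun x => F.sup fun i => ψ i x) := fun y z =>
  Finset.sup_le fun i hi => (h i y z).trans
    (add_le_add_left (Finset.le_sup (f := fun i => ψ i y) hi) _)

/-- Tensoring with a flat weight preserves finite suprema of coweights. -/
theorem IsFlat.tensor_finset_sup {d : LawvereMetric X} {φ : X → ℝ≥0∞} (hφ : d.IsFlat φ)
    {ι : Type*} (F : Finset ι) {ψ : ι → X → ℝ≥0∞} (h : ∀ i, d.IsCoweight (ψ i)) :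
    tensor φ (fun x => F.sup fun i => ψ i x) = F.sup fun i => tensor φ (ψ i) := by
  classical
  induction F using Finset.induction_on with
  | empty => simpa using hφ.tensor_const 0
  | insert i F hi ih =>
    simp only [Finset.sup_insert]
    rw [← ih]
    exact hφ.2.2 _ _ (h i) (isCoweight_finset_sup F h)

/-- The left Kan extension of a weight along a map. -/
noncomputable def pushWeight (dY : LawvereMetric Y) (f : X → Y) (φ : X → ℝ≥0∞) (y : Y) : ℝ≥0∞ :=
  ⨅ x, (φ x + dY.dist y (f x))

theorem isWeight_pushWeight (dY : LawvereMetric Y) (f : X → Y) (φ : X → ℝ≥0∞) :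
    dY.IsWeight (dY.pushWeight f φ) := fun y z => by
  rw [pushWeight, pushWeight, ENNReal.iInf_add]
  refine iInf_mono fun x => ?_
  rw [add_assoc, add_comm (dY.dist z (f x))]
  exact add_le_add_right (dY.triangle _ _ _) _

/-- A coweight absorbs the distance from `y` to `f x`, so only the points `f x` matter. Flatness is
tested by tensors and thus passes to the extension. -/
theorem tensor_pushWeight (dY : LawvereMetric Y) (f : X → Y) (φ : X → ℝ≥0∞) {ψ : Y → ℝ≥0∞}
    (hψ : dY.IsCoweight ψ) : tensor (dY.pushWeight f φ) ψ = tensor φ (ψ ∘ f) := by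
  refine le_antisymm (le_iInf fun x => ?_) (le_iInf fun y => ?_)
  · refine (iInf_le _ (f x)).trans (add_le_add_left ((iInf_le _ x).trans_eq ?_) _)
    rw [dY.dist_self, add_zero]
  · rw [pushWeight, ENNReal.iInf_add]
    refine le_iInf fun x => (iInf_le _ x).trans ?_
    rw [add_assoc, add_comm (dY.dist y (f x))]
    exact add_le_add_right (hψ y (f x)) _

theorem IsFlat.pushWeight {dX : LawvereMetric X} {dY : LawvereMetric Y} {f : X → Y}
    (hf : IsNonexpansive dX dY f) {φ : X → ℝ≥0∞} (hφ : dX.IsFlat φ) :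
    dY.IsFlat (dY.pushWeight f φ) := by
  refine ⟨isWeight_pushWeight _ _ _, ?_, fun ψ₁ ψ₂ h₁ h₂ => ?_⟩
  · have := tensor_pushWeight dY f φ (isCoweight_const dY 0)
    simpa [tensor, hφ.2.1] using this
  · have h : ∀ ψ, dY.IsCoweight ψ → dX.IsCoweight (ψ ∘ f) := fun ψ hψ x y =>
      (hψ (f x) (f y)).trans (add_le_add_right (hf x y) _)
    rw [tensor_pushWeight _ _ _ h₁, tensor_pushWeight _ _ _ h₂, tensor_pushWeight _ _ _ (h₁.sup h₂)]
    exact hφ.2.2 _ _ (h _ h₁) (h _ h₂)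

/-! ### Forward Cauchy nets and flat weights -/

section Nets

variable {I : Type v} [Preorder I]

theorem iInf_iSup_eq_limsup [Nonempty I] [IsDirectedOrder I] (f : I → ℝ≥0∞) :
    ⨅ i : I, ⨆ j : I, ⨆ _ : i ≤ j, f j = limsup f atTop := by
  simp [atTop_basis.limsup_eq_iInf_iSup]

theorem IsForwardCauchy.exists_forall_le {d : LawvereMetric X} {x : I → X}
    (hx : d.IsForwardCauchy x) {ε : ℝ≥0∞} (hε : 0 < ε) :
    ∃ i, ∀ j, i ≤ j → ∀ k, j ≤ k → d.dist (x j) (x k) ≤ ε := by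
  rw [← show _ = (0 : ℝ≥0∞) from hx] at hε
  obtain ⟨i, hi⟩ := iInf_lt_iff.1 hε
  refine ⟨i, fun j hj k hk => le_trans ?_ hi.le⟩
  exact le_iSup₂_of_le j hj (le_iSup₂ (f := fun k (_ : j ≤ k) => d.dist (x j) (x k)) k hk)

/-- The weight of a net; it is flat if the net is forward Cauchy. -/
noncomputable def netWeight (d : LawvereMetric X) (x : I → X) (z : X) : ℝ≥0∞ :=
  limsup (fun j => d.dist z (x j)) atTop

theorem IsForwardCauchy.eventually_netWeight_le {d : LawvereMetric X} {x : I → X}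
    (hx : d.IsForwardCauchy x) {ε : ℝ≥0∞} (hε : 0 < ε) :
    ∀ᶠ j in atTop, d.netWeight x (x j) ≤ ε := by
  obtain ⟨i, hi⟩ := hx.exists_forall_le hε
  filter_upwards [eventually_ge_atTop i] with j hj
  refine limsup_le_of_le (by isBoundedDefault) ?_
  filter_upwards [eventually_ge_atTop j] with k hk
  exact hi j hj k hk

variable [Nonempty I] [IsDirectedOrder I]

theorem isWeight_netWeight (d : LawvereMetric X) (x : I → X) : d.IsWeight (d.netWeight x) := by
  intro y z
  rw [netWeight, netWeight, add_comm, ← limsup_const_add _ _ _ (by isBoundedDefault)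
    (by isBoundedDefault)]
  exact limsup_le_limsup (Eventually.of_forall fun j => d.triangle y z (x j))

/-- The net weight is eventually at most `ε` on the net itself, so the net nearly attains the
infimum. Flatness follows because `limsup` commutes with `max`. -/
theorem IsForwardCauchy.tensor_netWeight {d : LawvereMetric X} {x : I → X}
    (hx : d.IsForwardCauchy x) {ψ : X → ℝ≥0∞} (hψ : d.IsCoweight ψ) :
    tensor (d.netWeight x) ψ = limsup (fun j => ψ (x j)) atTop := by
  refine le_antisymm ?_ (le_iInf fun z => ?_)
  · refine ENNReal.le_of_forall_pos_le_add fun ε hε _ => ?_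
    rw [add_comm, ← limsup_const_add _ _ _ (by isBoundedDefault) (by isBoundedDefault)]
    refine le_limsup_of_frequently_le (Eventually.frequently ?_)
    filter_upwards [hx.eventually_netWeight_le (ε := ε) (by exact_mod_cast hε)] with j hj
    exact (iInf_le _ (x j)).trans (add_le_add_left hj _)
  · rw [netWeight, add_comm, ← limsup_const_add _ _ _ (by isBoundedDefault) (by isBoundedDefault)]
    exact limsup_le_limsup (Eventually.of_forall fun j => hψ z (x j))

theorem IsForwardCauchy.isFlat_netWeight {d : LawvereMetric X} {x : I → X}
    (hx : d.IsForwardCauchy x) : d.IsFlat (d.netWeight x) := by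
  refine ⟨d.isWeight_netWeight x, ?_, fun ψ₁ ψ₂ h₁ h₂ => ?_⟩
  · simpa [tensor] using hx.tensor_netWeight (d.isCoweight_const 0)
  · rw [hx.tensor_netWeight h₁, hx.tensor_netWeight h₂, hx.tensor_netWeight (h₁.sup h₂),
      limsup_max]

theorem IsForwardCauchy.weightDist_netWeight {d : LawvereMetric X} {x : I → X}
    (hx : d.IsForwardCauchy x) {h : X → ℝ≥0∞} (hh : d.IsWeight h) :
    weightDist (d.netWeight x) h = limsup (fun j => h (x j)) atTop := by
  refine le_antisymm (weightDist_le_iff.2 fun z => ?_) ?_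
  -- Tail suprema decrease along a directed index, so the two infima merge into one over a common
  -- `i`.
  · rw [netWeight, ← iInf_iSup_eq_limsup, ← iInf_iSup_eq_limsup, ENNReal.iInf_add_iInf]
    · refine le_iInf fun i => (hh z (x i)).trans ?_
      rw [add_comm]
      exact add_le_add (le_iSup₂ (f := fun j (_ : i ≤ j) => d.dist z (x j)) i le_rfl)
        (le_iSup₂ (f := fun j (_ : i ≤ j) => h (x j)) i le_rfl)
    · intro i j
      obtain ⟨k, hi, hj⟩ := exists_ge_ge i j
      exact ⟨k, add_le_add
        (iSup₂_le fun l hl => le_iSup₂ (f := fun j (_ : i ≤ j) => d.dist z (x j)) l (hi.trans hl))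
        (iSup₂_le fun l hl => le_iSup₂ (f := fun i (_ : j ≤ i) => h (x i)) l (hj.trans hl))⟩
  · refine ENNReal.le_of_forall_pos_le_add fun ε hε _ => ?_
    refine limsup_le_of_le (by isBoundedDefault) ?_
    filter_upwards [hx.eventually_netWeight_le (ε := ε) (by exact_mod_cast hε)] with j hj
    refine (le_add_weightDist (d.netWeight x) h (x j)).trans ?_
    rw [add_comm]
    exact add_le_add_right hj _

theorem IsForwardCauchy.isColimit_netWeight_iff {d : LawvereMetric X} {x : I → X}
    (hx : d.IsForwardCauchy x) {a : X} :
    d.IsColimit (d.netWeight x) a ↔ d.IsYonedaLimit x a :=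
  forall_congr' fun y => by
    rw [hx.weightDist_netWeight (d.isWeight_dist y), iInf_iSup_eq_limsup, eq_comm]

end Nets

theorem IsCocomplete.isYonedaComplete {d : LawvereMetric X} (h : d.IsCocomplete) :
    d.IsYonedaComplete := fun _ _ _ _ x hx =>
  (h _ (d.isWeight_netWeight x)).imp fun _ ha => hx.isColimit_netWeight_iff.1 ha

/-- The equation makes the unit and counit distances zero; the triangle inequality then gives
non-expansiveness. -/
theorem isAdjoint_of_dist_eq {dX : LawvereMetric X} {dY : LawvereMetric Y} {f : X → Y}
    {g : Y → X} (h : ∀ x y, dY.dist (f x) y = dX.dist x (g y)) : IsAdjoint dX dY f g := by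
  refine ⟨fun x x' => ?_, fun y y' => ?_, h⟩
  · rw [h]
    refine (dX.triangle x x' _).trans_eq ?_
    rw [← h, dY.dist_self, add_zero]
  · rw [← h]
    refine (dY.triangle _ y y').trans_eq ?_
    rw [h, dX.dist_self, zero_add]

/-! ### The cube and its finitary points -/

section Cube

variable {I : Type u}

/-- The product of copies of `[0, ∞]` with the metric `x ⊖ y`. -/
noncomputable def cubeMetric (I : Type u) : LawvereMetric (I → ℝ≥0∞) where
  dist x y := ⨆ i, (x i - y i)
  dist_self x := by simp
  triangle x y z := iSup_le fun i => tsub_le_tsub_add_tsub.trans <|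
    add_le_add (le_iSup (fun i => x i - y i) i) (le_iSup (fun i => y i - z i) i)

theorem cubeMetric_dist_le_iff {x y : I → ℝ≥0∞} {c : ℝ≥0∞} :
    (cubeMetric I).dist x y ≤ c ↔ ∀ i, x i ≤ y i + c := by
  simp only [cubeMetric, iSup_le_iff, tsub_le_iff_left]

theorem cubeMetric_dist_eq_zero {x y : I → ℝ≥0∞} (h : x ≤ y) : (cubeMetric I).dist x y = 0 :=
  le_bot_iff.1 (cubeMetric_dist_le_iff.2 fun i => (h i).trans le_self_add)

theorem cubeMetric_dist_mono {x x' : I → ℝ≥0∞} (h : x ≤ x') (y : I → ℝ≥0∞) :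
    (cubeMetric I).dist x y ≤ (cubeMetric I).dist x' y :=
  iSup_mono fun i => tsub_le_tsub_right (h i) _

/-- Finite-valued points of finite support; they are the compact elements of the cube. -/
def IsFinitary (b : I → ℝ≥0∞) : Prop :=
  b.support.Finite ∧ ∀ i, b i ≠ ∞

theorem IsFinitary.sup {b c : I → ℝ≥0∞} (hb : IsFinitary b) (hc : IsFinitary c) :
    IsFinitary (b ⊔ c) := by
  refine ⟨(hb.1.union hc.1).subset fun i hi => ?_, fun i => ?_⟩
  · by_contra h
    simp only [Set.mem_union, Function.mem_support, not_or, not_not] at h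
    exact hi (by simp [h.1, h.2])
  · simp [hb.2 i, hc.2 i]

theorem IsFinitary.mono {b c : I → ℝ≥0∞} (hc : IsFinitary c) (h : b ≤ c) : IsFinitary b := by
  refine ⟨hc.1.subset fun i hi hi' => hi ?_, fun i => ne_top_of_le_ne_top (hc.2 i) (h i)⟩
  exact le_bot_iff.1 ((h i).trans_eq hi')

/-- The finitary points below a point of the cube. -/
abbrev FinitaryBelow (y : I → ℝ≥0∞) : Type u := {b : I → ℝ≥0∞ // IsFinitary b ∧ b ≤ y}

instance (y : I → ℝ≥0∞) : Nonempty (FinitaryBelow y) :=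
  ⟨⟨0, by simp [IsFinitary], fun _ => zero_le⟩⟩

instance (y : I → ℝ≥0∞) : IsDirectedOrder (FinitaryBelow y) :=
  ⟨fun b c => ⟨⟨b.1 ⊔ c.1, b.2.1.sup c.2.1, sup_le b.2.2 c.2.2⟩,
    le_sup_left (a := b.1), le_sup_right (a := b.1)⟩⟩

open Classical in
theorem isFinitary_single {i : I} {t : ℝ≥0∞} (ht : t ≠ ∞) :
    IsFinitary (Pi.single i t : I → ℝ≥0∞) := by
  refine ⟨(Set.finite_singleton i).subset Pi.support_single_subset, fun j => ?_⟩
  by_cases h : j = i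
  · subst h
    simpa using ht
  · simp [h]

/-- A coordinate of a point is the supremum of its values at the finitary points below. -/
theorem exists_finitaryBelow {y : I → ℝ≥0∞} {i : I} {t : ℝ≥0∞} (ht : t < y i) :
    ∃ b : FinitaryBelow y, b.1 i = t := by
  classical
  refine ⟨⟨Pi.single i t, isFinitary_single ht.ne_top, fun j => ?_⟩, by simp⟩
  by_cases h : j = i
  · subst h
    simpa using ht.le
  · simp [h]

theorem iSup_finitaryBelow_dist (y z : I → ℝ≥0∞) :
    ⨆ b : FinitaryBelow y, (cubeMetric I).dist b.1 z = (cubeMetric I).dist y z := by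
  refine le_antisymm (iSup_le fun b => cubeMetric_dist_mono b.2.2 z) ?_
  refine cubeMetric_dist_le_iff.2 fun i => le_of_forall_lt fun t ht => ?_
  obtain ⟨u, htu, hu⟩ := exists_between ht
  obtain ⟨b, hb⟩ := exists_finitaryBelow hu
  refine htu.trans_le ?_
  rw [← hb]
  exact cubeMetric_dist_le_iff.1
    (le_iSup (fun b : FinitaryBelow y => (cubeMetric I).dist b.1 z) b) i

/-- The approach distance of the cube. -/
noncomputable def cubeDistance (I : Type u) : ApproachDistance (I → ℝ≥0∞) where
  dist y A := ⨆ b : FinitaryBelow y, ⨅ a ∈ A, (cubeMetric I).dist b.1 a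
  dist_singleton y := by
    simp only [Set.mem_singleton_iff, iInf_iInf_eq_left, iSup_finitaryBelow_dist]
    exact (cubeMetric I).dist_self y
  dist_empty y := by simp
  dist_union y A B := by
    simp only [iInf_union]
    refine le_antisymm (le_min (iSup_mono fun b => inf_le_left) (iSup_mono fun b => inf_le_right))
      (le_of_forall_lt fun c hc => ?_)
    obtain ⟨hA, hB⟩ := lt_min_iff.1 hc
    obtain ⟨b, hb⟩ := lt_iSup_iff.1 hA
    obtain ⟨b', hb'⟩ := lt_iSup_iff.1 hB
    -- Directedness lets one finitary point witness both bounds.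
    obtain ⟨m, hm, hm'⟩ := exists_ge_ge b b'
    refine lt_iSup_iff.2 ⟨m, lt_min (hb.trans_le ?_) (hb'.trans_le ?_)⟩
    · exact iInf₂_mono fun a _ => cubeMetric_dist_mono hm a
    · exact iInf₂_mono fun a _ => cubeMetric_dist_mono hm' a
  triangle y A B := by
    refine iSup_le fun b => ?_
    set r := ⨆ b : FinitaryBelow y, ⨅ a ∈ B, (cubeMetric I).dist b.1 a
    set S := ⨆ β ∈ B, ⨆ b : FinitaryBelow β, ⨅ a ∈ A, (cubeMetric I).dist b.1 a
    refine ENNReal.le_of_forall_pos_le_add fun ε hε hlt => ?_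
    have hr : r < r + ε := ENNReal.lt_add_right (lt_of_le_of_lt le_self_add hlt).ne
      (by exact_mod_cast hε.ne')
    have hb : ⨅ a ∈ B, (cubeMetric I).dist b.1 a < r + ε :=
      (le_iSup (fun b : FinitaryBelow y => ⨅ a ∈ B, (cubeMetric I).dist b.1 a) b).trans_lt hr
    obtain ⟨β, hβ⟩ := iInf_lt_iff.1 hb
    obtain ⟨hβB, hβ⟩ := iInf_lt_iff.1 hβ
    -- Lowering `b` by `r + ε` puts it below `β` while keeping it finitary and within `r + ε` of
    -- `b`.
    let c : I → ℝ≥0∞ := fun i => b.1 i - (r + ε)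
    have hc : IsFinitary c := b.2.1.mono fun i => tsub_le_self
    have hcβ : c ≤ β := fun i => tsub_le_iff_right.2 (cubeMetric_dist_le_iff.1 hβ.le i)
    have hS : ⨅ a ∈ A, (cubeMetric I).dist c a ≤ S :=
      le_iSup₂_of_le β hβB (le_iSup (fun b : FinitaryBelow β =>
        ⨅ a ∈ A, (cubeMetric I).dist b.1 a) ⟨c, hc, hcβ⟩)
    have hbc : (cubeMetric I).dist b.1 c ≤ r + ε :=
      cubeMetric_dist_le_iff.2 fun i => le_tsub_add
    calc ⨅ a ∈ A, (cubeMetric I).dist b.1 a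
        ≤ ⨅ a ∈ A, ((r + ε) + (cubeMetric I).dist c a) :=
          iInf₂_mono fun a _ => ((cubeMetric I).triangle b.1 c a).trans (add_le_add_left hbc _)
      _ = (r + ε) + ⨅ a ∈ A, (cubeMetric I).dist c a := by
          by_cases hA : A.Nonempty
          · simp only [ENNReal.add_iInf₂]
          · simp [Set.not_nonempty_iff_eq_empty.1 hA]
      _ ≤ (r + ε) + S := add_le_add_right hS _
      _ = r + S + ε := add_right_comm _ _ _

theorem cubeDistance_singleton (y z : I → ℝ≥0∞) :
    (cubeDistance I).dist y {z} = (cubeMetric I).dist y z := by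
  simp only [cubeDistance, Set.mem_singleton_iff, iInf_iInf_eq_left, iSup_finitaryBelow_dist]

/-- Every point of the cube is in the closure of the finitary points below it. -/
theorem cubeDistance_finitaryBelow (y : I → ℝ≥0∞) :
    (cubeDistance I).dist y {b | IsFinitary b ∧ b ≤ y} = 0 :=
  le_bot_iff.1 <| iSup_le fun b => (iInf₂_le b.1 b.2).trans_eq ((cubeMetric I).dist_self _)

/-- The coordinatewise colimit of a weight along a map into the cube. -/
noncomputable def cubeColim {X : Type v} (s : X → I → ℝ≥0∞) (φ : X → ℝ≥0∞) : I → ℝ≥0∞ :=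
  fun i => ⨆ x, (s x i - φ x)

/-- Either side is at most `c` exactly when `s x i ≤ φ x + y i + c` for all `x` and `i`. -/
theorem cubeMetric_dist_cubeColim {X : Type v} (s : X → I → ℝ≥0∞) (φ : X → ℝ≥0∞)
    (y : I → ℝ≥0∞) :
    (cubeMetric I).dist (cubeColim s φ) y
      = weightDist φ (fun x => (cubeMetric I).dist (s x) y) := by
  refine eq_of_forall_ge_iff fun c => ?_
  rw [cubeMetric_dist_le_iff, weightDist_le_iff]
  simp only [cubeMetric_dist_le_iff, cubeColim, iSup_le_iff, tsub_le_iff_left]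
  rw [forall_comm]
  exact forall_congr' fun x => forall_congr' fun i => by rw [add_left_comm]

theorem isCoweight_tsub_coord (i : I) (t : ℝ≥0∞) :
    (cubeMetric I).IsCoweight (fun z => t - z i) := fun y z =>
  tsub_le_tsub_add_tsub.trans (add_le_add_right (le_iSup (fun i => y i - z i) i) _)

/-- Evaluating the tensor at `z` suffices when `z i ≤ t`. If `z i` exceeds `t`, the excess is lost
in `t ⊖ z i`; flatness recovers it by raising `t` to `t + k` and taking the maximum with the
constant `k`. -/
theorem IsFlat.tensor_tsub_coord_le {φ : (I → ℝ≥0∞) → ℝ≥0∞} (hφ : (cubeMetric I).IsFlat φ)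
    (i : I) {t : ℝ≥0∞} (ht : t ≠ ∞) (z : I → ℝ≥0∞) :
    tensor φ (fun y => t - y i) ≤ t - (z i - φ z) := by
  set T := tensor φ (fun y => t - y i) with hT
  have hTt : T ≤ t := (tensor_mono φ fun y => tsub_le_self).trans_eq (hφ.tensor_const t)
  rcases le_total (z i) (φ z) with h | h
  · simpa [tsub_eq_zero_of_le h] using hTt
  have hTz : T ≤ φ z + (t - z i) := iInf_le _ z
  rcases le_total (z i) t with h' | h'
  · refine hTz.trans (le_of_eq ?_)
    have hz : z i ≠ ∞ := ne_top_of_le_ne_top ht h'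
    have hφz : φ z ≠ ∞ := ne_top_of_le_ne_top hz h
    lift t to NNReal using ht
    generalize z i = a at *
    generalize φ z = b at *
    lift a to NNReal using hz
    lift b to NNReal using hφz
    norm_cast at *
    rw [← NNReal.coe_inj]
    rw [NNReal.coe_add, NNReal.coe_sub h', NNReal.coe_sub (tsub_le_self.trans h'),
      NNReal.coe_sub h]
    ring
  · -- compare with the coweight given by the `i`-th coordinate and a constant
    have key : ∀ k, t + k ≤ z i → k ≠ ∞ → T + k ≤ max (φ z) k := by
      intro k hk hk'
      have h1 := hφ.2.2 (fun y => t + k - y i) (fun _ => k) (isCoweight_tsub_coord i (t + k))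
        (isCoweight_const _ k)
      rw [hφ.tensor_const] at h1
      calc T + k = tensor φ (fun y => (t - y i) + k) := by
            rw [hT, tensor, tensor, ENNReal.iInf_add]
            simp only [add_assoc]
        _ ≤ tensor φ (fun y => max (t + k - y i) k) := by
            refine tensor_mono φ fun y => ?_
            rcases le_total t (y i) with hy | hy
            · simp [tsub_eq_zero_of_le hy]
            · refine le_max_of_le_left ?_
              refine ENNReal.le_sub_of_add_le_right (ne_top_of_le_ne_top ht hy) ?_
              rw [add_right_comm, tsub_add_cancel_of_le hy]
        _ = max (tensor φ (fun y => t + k - y i)) k := h1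
        _ ≤ max (φ z) k := by
            refine max_le_max_right _ ((iInf_le _ z).trans_eq ?_)
            simp [tsub_eq_zero_of_le hk]
    -- The optimal shift is the smaller of `φ z` and `z i - t`; the first makes the tensor vanish.
    rcases le_total (t + φ z) (z i) with h1 | h1
    · by_cases hφz : φ z = ∞
      · have hz : z i = ∞ := top_le_iff.1 (hφz ▸ h)
        simpa [hz, hφz] using hTt
      · have h2 := key (φ z) h1 hφz
        rw [max_self] at h2
        have : T ≤ 0 := by
          refine (ENNReal.add_le_add_iff_right hφz).1 ?_
          simpa using h2
        exact this.trans zero_le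
    · by_cases hz : z i = ∞
      · have hφz : φ z = ∞ := by simpa [hz, ht] using h1
        simpa [hz, hφz] using hTt
      · have h2 := key (z i - t) (add_tsub_cancel_of_le h').le (ENNReal.sub_ne_top hz)
        have h3 : z i - t ≤ φ z := tsub_le_iff_left.2 h1
        rw [max_eq_left h3] at h2
        refine ENNReal.le_sub_of_add_le_right
          (ne_top_of_le_ne_top hz tsub_le_self) ?_
        have h4 : T + z i ≤ t + φ z := by
          calc T + z i = T + (z i - t) + t := by rw [add_assoc, tsub_add_cancel_of_le h']
            _ ≤ φ z + t := add_le_add_left h2 _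
            _ = t + φ z := add_comm _ _
        have hφz : φ z ≠ ∞ := ne_top_of_le_ne_top hz h
        refine (ENNReal.add_le_add_iff_right hφz).1 ?_
        rwa [add_assoc, tsub_add_cancel_of_le h]

/-- Finitary points are compact: a flat weight takes the same value at them as the weight
represented by its colimit. -/
theorem IsFlat.le_dist_cubeColim {φ : (I → ℝ≥0∞) → ℝ≥0∞} (hφ : (cubeMetric I).IsFlat φ)
    {b : I → ℝ≥0∞} (hb : IsFinitary b) : φ b ≤ (cubeMetric I).dist b (cubeColim id φ) := by
  -- Finite support makes the distance a finite supremum, which the flat weight preserves.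
  have h1 : (cubeMetric I).dist b = fun z => hb.1.toFinset.sup fun i => b i - z i := by
    funext z
    refine le_antisymm (iSup_le fun i => ?_)
      (Finset.sup_le fun i _ => le_iSup (fun i => b i - z i) i)
    by_cases hi : b i = 0
    · simp [hi]
    · exact Finset.le_sup (f := fun i => b i - z i) (by simpa using hi)
  rw [← tensor_dist _ hφ.1, h1, hφ.tensor_finset_sup _ fun i => isCoweight_tsub_coord i (b i)]
  refine Finset.sup_mono_fun fun i _ => ?_
  -- Subtraction turns the supremum into an infimum because `b i` is finite.
  rw [cubeColim, ENNReal.sub_iSup (hb.2 i)]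
  exact le_iInf fun z => hφ.tensor_tsub_coord_le i (hb.2 i) z

end Cube

end LawvereMetric

/-! ### Embedding approach spaces in cubes -/

namespace ApproachDistance

open LawvereMetric Filter

variable {X : Type u}

theorem dist_eq_zero_of_mem (δ : ApproachDistance X) {x : X} {A : Set X} (h : x ∈ A) :
    δ.dist x A = 0 := by
  rw [← Set.insert_eq_of_mem h, Set.insert_eq, δ.dist_union, δ.dist_singleton]
  exact min_eq_left zero_le

theorem dist_biUnion_finset (δ : ApproachDistance X) (x : X) {ι : Type*} (F : Finset ι)
    (A : ι → Set X) : δ.dist x (⋃ i ∈ F, A i) = F.inf fun i => δ.dist x (A i) := by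
  classical
  induction F using Finset.induction_on with
  | empty => simp [δ.dist_empty]
  | insert i F hi ih => rw [Finset.set_biUnion_insert, δ.dist_union, ih, Finset.inf_insert]

theorem isWeight_dist (δ : ApproachDistance X) (A : Set X) :
    δ.specializationMetric.IsWeight (fun x => δ.dist x A) := fun x y =>
  (δ.triangle x A {y}).trans_eq (by simp [specializationMetric, add_comm])

/-- The embedding of an approach space into a cube. -/
noncomputable def toCube (δ : ApproachDistance X) (x : X) : Set X → ℝ≥0∞ := δ.dist x

/-- For `≤`, a point supported at the coordinate `A` suffices, since `δ(a, A) = 0` on `A`. For `≥`,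
a finitary `b` violating the bound splits `A` into finitely many pieces, one per coordinate in its
support; the union axiom finds a piece close to `x`, contradicting the triangle inequality. -/
theorem dist_eq_cubeDistance (δ : ApproachDistance X) (x : X) (A : Set X) :
    δ.dist x A = (cubeDistance (Set X)).dist (δ.toCube x) (δ.toCube '' A) := by
  refine le_antisymm (le_of_forall_lt fun t ht => ?_) (iSup_le fun b => ?_)
  · obtain ⟨u, htu, hu⟩ := exists_between ht
    obtain ⟨b, hb⟩ := exists_finitaryBelow (y := δ.toCube x) (i := A) hu
    refine htu.trans_le (le_iSup_of_le b ?_)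
    rw [iInf_image]
    refine le_iInf₂ fun a ha => ?_
    refine le_trans ?_ (le_iSup (fun i => b.1 i - δ.toCube a i) A)
    simp only [toCube, δ.dist_eq_zero_of_mem ha, hb, tsub_zero, le_refl]
  · rw [iInf_image]
    refine le_of_not_gt fun hlt => ?_
    obtain ⟨r, hr, hr'⟩ := exists_between hlt
    have hcover : A ⊆ ⋃ i ∈ b.2.1.1.toFinset, {a | r + δ.dist a i ≤ b.1 i} := by
      intro a ha
      have h1 := hr'.trans_le (iInf₂_le a ha)
      obtain ⟨i, hi⟩ := lt_iSup_iff.1 h1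
      have h2 : r + δ.dist a i < b.1 i := lt_tsub_iff_right.1 hi
      simp only [Set.mem_iUnion]
      exact ⟨i, by simpa using (bot_le.trans_lt h2).ne', h2.le⟩
    have hle : δ.dist x (⋃ i ∈ b.2.1.1.toFinset, {a | r + δ.dist a i ≤ b.1 i}) < r := by
      refine lt_of_le_of_lt ?_ hr
      rw [← Set.union_eq_self_of_subset_left hcover, δ.dist_union]
      exact min_le_left _ _
    rw [dist_biUnion_finset, Finset.inf_lt_iff] at hle
    obtain ⟨i, -, hi⟩ := hle
    rcases Set.eq_empty_or_nonempty {a | r + δ.dist a i ≤ b.1 i} with he | ⟨a, ha⟩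
    · rw [he, δ.dist_empty] at hi
      exact not_top_lt hi
    · have hri : r ≤ b.1 i := le_self_add.trans ha
      have hsup : ⨆ a ∈ {a | r + δ.dist a i ≤ b.1 i}, δ.dist a i ≤ b.1 i - r :=
        iSup₂_le fun a (ha : r + δ.dist a i ≤ b.1 i) =>
          ENNReal.le_sub_of_add_le_left hr'.ne_top ha
      have h1 : b.1 i ≤ δ.dist x {a | r + δ.dist a i ≤ b.1 i} + (b.1 i - r) :=
        (b.2.2 i).trans <| (δ.triangle x i _).trans <| add_le_add_right hsup _
      -- Finiteness of `b i` keeps the inequality strict after addition.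
      have h2 : b.1 i - r ≠ ∞ := ENNReal.sub_ne_top (b.2.1.2 i)
      have h3 := h1.trans_lt (ENNReal.add_lt_add_right h2 hi)
      rw [add_tsub_cancel_of_le hri] at h3
      exact h3.false

theorem isEmbedding_toCube (δ : ApproachDistance X) :
    IsEmbedding δ (cubeDistance (Set X)) δ.toCube :=
  ⟨fun x A => (δ.dist_eq_cubeDistance x A).ge, δ.dist_eq_cubeDistance⟩

/-- An injective approach space is a retract of a cube. -/
theorem IsInjective.exists_retraction {δ : ApproachDistance X} (h : δ.IsInjective) :
    ∃ r : (Set X → ℝ≥0∞) → X, IsContraction (cubeDistance (Set X)) δ r ∧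
      ∀ x, r (δ.toCube x) = x := by
  obtain ⟨r, hr, hid⟩ := h X _ δ _ δ.toCube id δ.isEmbedding_toCube fun x A => by simp
  exact ⟨r, hr, fun x => (congrFun hid x).symm⟩

theorem cubeMetric_dist_toCube (δ : ApproachDistance X) (x y : X) :
    (cubeMetric (Set X)).dist (δ.toCube x) (δ.toCube y) = δ.dist x {y} := by
  rw [δ.dist_eq_cubeDistance, Set.image_singleton, cubeDistance_singleton]

/-! ### Retracts of cubes -/

section Retract

variable {δ : ApproachDistance X} {r : (Set X → ℝ≥0∞) → X}

theorem dist_retract_le (hr : IsContraction (cubeDistance (Set X)) δ r)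
    (y z : Set X → ℝ≥0∞) :
    δ.dist (r y) {r z} ≤ (cubeMetric (Set X)).dist y z := by
  rw [← cubeDistance_singleton]
  simpa using hr y {z}

theorem dist_retract_le_of_le (hr : IsContraction (cubeDistance (Set X)) δ r)
    {y z : Set X → ℝ≥0∞} (h : y ≤ z) : δ.dist (r y) {r z} = 0 :=
  le_bot_iff.1 ((dist_retract_le hr y z).trans_eq (cubeMetric_dist_eq_zero h))

/-- The net of images of finitary points below `y`. -/
theorem isForwardCauchy_retract (hr : IsContraction (cubeDistance (Set X)) δ r)
    (y : Set X → ℝ≥0∞) :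
    δ.specializationMetric.IsForwardCauchy (fun b : FinitaryBelow y => r b.1) := by
  refine le_bot_iff.1 ((iInf_le _ (Classical.arbitrary _)).trans ?_)
  refine iSup₂_le fun j _ => iSup₂_le fun k hjk => ?_
  exact (dist_retract_le_of_le hr (show j.1 ≤ k.1 from hjk)).le

/-- Lower regular functions on the retract are Scott continuous along finitary points. -/
theorem dist_retract_eq_limsup (hr : IsContraction (cubeDistance (Set X)) δ r)
    (y : Set X → ℝ≥0∞) (A : Set X) :
    δ.dist (r y) A = limsup (fun b : FinitaryBelow y => δ.dist (r b.1) A) atTop := by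
  have hmono : ∀ {b c : Set X → ℝ≥0∞}, b ≤ c → δ.dist (r b) A ≤ δ.dist (r c) A := fun h =>
    (δ.isWeight_dist A _ _).trans_eq
      (by rw [show δ.specializationMetric.dist _ _ = 0 from dist_retract_le_of_le hr h, add_zero])
  refine le_antisymm ?_ (limsup_le_of_le (by isBoundedDefault)
    (Eventually.of_forall fun b => hmono b.2.2))
  -- The contraction `r` keeps `r y` at distance zero from the images of the finitary points below
  -- `y`.
  have h1 := hr y {b | IsFinitary b ∧ b ≤ y}
  rw [cubeDistance_finitaryBelow] at h1
  refine (δ.triangle _ A (r '' {b | IsFinitary b ∧ b ≤ y})).trans ?_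
  rw [le_bot_iff.1 h1, bot_eq_zero, zero_add]
  refine iSup₂_le ?_
  rintro _ ⟨b, hb, rfl⟩
  refine le_limsup_of_frequently_le (Eventually.frequently ?_)
  filter_upwards [eventually_ge_atTop (⟨b, hb⟩ : FinitaryBelow y)] with c hc
  exact hmono hc

theorem isYonedaLimit_retract (hr : IsContraction (cubeDistance (Set X)) δ r)
    (y : Set X → ℝ≥0∞) :
    δ.specializationMetric.IsYonedaLimit (fun b : FinitaryBelow y => r b.1) (r y) := fun z => by
  rw [iInf_iSup_eq_limsup]
  exact dist_retract_eq_limsup hr y {z}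

/-- The coordinatewise colimit has the required distances to the image of `X`, and `r` does not
increase distances. The reverse bound uses that the image of `x` is within `φ x` of that colimit. -/
theorem isColimit_retract (hr : IsContraction (cubeDistance (Set X)) δ r)
    (hrs : ∀ x, r (δ.toCube x) = x) (φ : X → ℝ≥0∞) :
    δ.specializationMetric.IsColimit φ (r (cubeColim δ.toCube φ)) := by
  intro y
  set c := cubeColim δ.toCube φ
  have hc : ∀ z, (cubeMetric (Set X)).dist c (δ.toCube z)
      = weightDist φ (fun x => δ.dist x {z}) := fun z => by
    rw [cubeMetric_dist_cubeColim]
    simp only [cubeMetric_dist_toCube]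
  refine le_antisymm (weightDist_le_iff.2 fun x => ?_) ?_
  · refine (δ.specializationMetric.triangle x (r c) y).trans (add_le_add_left ?_ _)
    have h1 := dist_retract_le hr (δ.toCube x) c
    rw [hrs] at h1
    refine h1.trans (cubeMetric_dist_le_iff.2 fun i => ?_)
    exact tsub_le_iff_right.1 (le_iSup (fun x => δ.toCube x i - φ x) x)
  · have h1 := dist_retract_le hr c (δ.toCube y)
    rw [hrs, hc] at h1
    exact h1

theorem isCocomplete_of_retract (hr : IsContraction (cubeDistance (Set X)) δ r)
    (hrs : ∀ x, r (δ.toCube x) = x) : δ.specializationMetric.IsCocomplete := fun φ _ =>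
  ⟨_, isColimit_retract hr hrs φ⟩

/-- A flat weight is bounded on finitary points by the distance to its coordinatewise colimit. -/
theorem retract_le_dist_cubeColim (hr : IsContraction (cubeDistance (Set X)) δ r)
    (hrs : ∀ x, r (δ.toCube x) = x)
    {φ : X → ℝ≥0∞} (hφ : δ.specializationMetric.IsFlat φ)
    {b : Set X → ℝ≥0∞} (hb : IsFinitary b) :
    φ (r b) ≤ (cubeMetric (Set X)).dist b (cubeColim δ.toCube φ) := by
  have hne : IsNonexpansive δ.specializationMetric (cubeMetric (Set X)) δ.toCube :=
    fun x y => (δ.cubeMetric_dist_toCube x y).le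
  have hpush : pushWeight (cubeMetric (Set X)) δ.toCube φ b
      ≤ (cubeMetric (Set X)).dist b (cubeColim δ.toCube φ) := by
    refine ((hφ.pushWeight hne).le_dist_cubeColim hb).trans ?_
    -- Pushing `φ` forward does not lower its coordinatewise colimit: at the image of `x` the pushed
    -- weight is at most `φ x`.
    refine iSup_mono fun i => tsub_le_tsub_left (iSup_le fun x => ?_) _
    refine le_iSup_of_le (δ.toCube x) (tsub_le_tsub_left ?_ _)
    refine (iInf_le _ x).trans_eq ?_
    rw [(cubeMetric _).dist_self, add_zero]
  refine le_trans (le_iInf fun x => ?_) hpush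
  refine (hφ.1 (r b) x).trans (add_le_add_right ?_ _)
  have h1 := dist_retract_le hr b (δ.toCube x)
  rwa [hrs] at h1

/-- Lower regular functions preserve colimits of flat weights. -/
theorem dist_flatColim_le (hr : IsContraction (cubeDistance (Set X)) δ r)
    (hrs : ∀ x, r (δ.toCube x) = x)
    {φ : X → ℝ≥0∞} (hφ : δ.specializationMetric.IsFlat φ) (A : Set X) :
    δ.dist (r (cubeColim δ.toCube φ)) A ≤ weightDist φ (fun x => δ.dist x A) := by
  rw [dist_retract_eq_limsup hr]
  refine limsup_le_of_le (by isBoundedDefault) (Eventually.of_forall fun b => ?_)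
  have h1 := retract_le_dist_cubeColim hr hrs hφ b.2.1
  rw [cubeMetric_dist_eq_zero b.2.2] at h1
  refine (le_add_weightDist φ (fun x => δ.dist x A) (r b.1)).trans ?_
  rw [le_bot_iff.1 h1, bot_eq_zero, zero_add]

theorem toCube_retract_cubeColim_le (hr : IsContraction (cubeDistance (Set X)) δ r)
    (hrs : ∀ x, r (δ.toCube x) = x)
    {φ : X → ℝ≥0∞} (hφ : δ.specializationMetric.IsFlat φ) :
    δ.toCube (r (cubeColim δ.toCube φ)) ≤ cubeColim δ.toCube φ := fun A =>
  dist_flatColim_le hr hrs hφ A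

/-- The space of flat weights of a retract of a cube is reflected into it by colimits. -/
theorem isAdjoint_colim_yoneda (hr : IsContraction (cubeDistance (Set X)) δ r)
    (hrs : ∀ x, r (δ.toCube x) = x) :
    IsAdjoint δ.specializationMetric.flatMetric δ.specializationMetric
      (fun φ => r (cubeColim δ.toCube φ.1)) δ.specializationMetric.yoneda :=
  isAdjoint_of_dist_eq fun φ y => (isColimit_retract hr hrs φ.1 y).symm

/-- The way-below weight of a point. -/
noncomputable def wayBelow (hr : IsContraction (cubeDistance (Set X)) δ r) (x : X) :
    δ.specializationMetric.FlatWeight :=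
  ⟨δ.specializationMetric.netWeight (fun b : FinitaryBelow (δ.toCube x) => r b.1),
    (isForwardCauchy_retract hr _).isFlat_netWeight⟩

/-- The left side is the limsup of `φ (r b)`. The main estimate bounds it above; below, `δ(x, {c})`
is the limsup of `δ(r b, {c})`, and each term is at most `φ (r b)`. -/
theorem isAdjoint_wayBelow_colim (hr : IsContraction (cubeDistance (Set X)) δ r)
    (hrs : ∀ x, r (δ.toCube x) = x) :
    IsAdjoint δ.specializationMetric δ.specializationMetric.flatMetric (wayBelow hr)
      (fun φ => r (cubeColim δ.toCube φ.1)) := by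
  refine isAdjoint_of_dist_eq fun x φ => ?_
  change weightDist (netWeight _ _) φ.1 = δ.dist x {r (cubeColim δ.toCube φ.1)}
  set c := cubeColim δ.toCube φ.1 with hc
  rw [(isForwardCauchy_retract hr _).weightDist_netWeight φ.2.1]
  refine le_antisymm (limsup_le_of_le (by isBoundedDefault) (Eventually.of_forall fun b => ?_)) ?_
  · refine (retract_le_dist_cubeColim hr hrs φ.2 b.2.1).trans
      ((cubeMetric_dist_mono b.2.2 _).trans ?_)
    rw [← δ.cubeMetric_dist_toCube]
    exact iSup_mono fun i => tsub_le_tsub_left (toCube_retract_cubeColim_le hr hrs φ.2 i) _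
  · have h1 := dist_retract_eq_limsup hr (δ.toCube x) {r c}
    rw [hrs] at h1
    rw [h1]
    refine limsup_le_limsup (Eventually.of_forall fun b => ?_)
    refine (weightDist_le_iff.1 (isColimit_retract hr hrs φ.1 (r c)).le (r b.1)).trans_eq ?_
    rw [δ.specializationMetric.dist_self, add_zero]

theorem isContinuous_of_retract (hr : IsContraction (cubeDistance (Set X)) δ r)
    (hrs : ∀ x, r (δ.toCube x) = x) :
    δ.specializationMetric.IsContinuous :=
  ⟨(isCocomplete_of_retract hr hrs).isYonedaComplete, _, isAdjoint_colim_yoneda hr hrs,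
    _, isAdjoint_wayBelow_colim hr hrs⟩

theorem isScottWeight_dist (hr : IsContraction (cubeDistance (Set X)) δ r)
    (hrs : ∀ x, r (δ.toCube x) = x) (A : Set X) :
    δ.specializationMetric.IsScottWeight (fun x => δ.dist x A) := by
  refine ⟨δ.isWeight_dist A, fun I _ _ _ x a hx ha => ?_⟩
  rw [iInf_iSup_eq_limsup, ← hx.weightDist_netWeight (δ.isWeight_dist A)]
  set φ := δ.specializationMetric.netWeight x
  set c := r (cubeColim δ.toCube φ)
  -- Both `a` and `c` are colimits of the net weight, so the claim reduces to the chosen colimit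
  -- `c`.
  have hac : δ.specializationMetric.dist a c = 0 := by
    rw [hx.isColimit_netWeight_iff.2 ha c |>.symm, isColimit_retract hr hrs φ c,
      δ.specializationMetric.dist_self]
  refine (δ.isWeight_dist A a c).trans ?_
  rw [hac, add_zero]
  exact dist_flatColim_le hr hrs hx.isFlat_netWeight A

theorem eq_scottDistance_of_retract (hr : IsContraction (cubeDistance (Set X)) δ r)
    (hrs : ∀ x, r (δ.toCube x) = x) :
    δ = δ.specializationMetric.scottDistance := by
  ext x A : 3
  refine le_antisymm ?_ (iSup₂_le fun ψ hψ => ?_)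
  · exact le_iSup₂_of_le (fun x => δ.dist x A) ⟨isScottWeight_dist hr hrs A,
      fun a ha => δ.dist_eq_zero_of_mem ha⟩ le_rfl
  · have h1 := hψ.1.2 _ _ _ (isForwardCauchy_retract hr (δ.toCube x))
      (isYonedaLimit_retract hr (δ.toCube x))
    rw [hrs, iInf_iSup_eq_limsup] at h1
    refine h1.trans (limsup_le_iSup.trans ?_)
    rw [δ.dist_eq_cubeDistance x A]
    refine iSup_mono fun b => ?_
    rw [iInf_image]
    -- As `ψ a = 0`, the value `ψ (r b)` is at most the distance from `r b` to `a`, hence from `b`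
    -- to the image of `a`.
    refine le_iInf₂ fun a ha => (hψ.1.1 (r b.1) a).trans ?_
    rw [hψ.2 a ha, zero_add]
    have h2 := dist_retract_le hr b.1 (δ.toCube a)
    rwa [hrs] at h2

end Retract

end ApproachDistance

theorem theorem5 {X : Type u} (δ : ApproachDistance X) (hT0 : δ.IsT0) (hinj : δ.IsInjective) :
    δ.specializationMetric.IsSeparated ∧
    δ.specializationMetric.IsCocomplete ∧
    δ.specializationMetric.IsContinuous ∧
    δ = δ.specializationMetric.scottDistance := by
  obtain ⟨r, hr, hrs⟩ := hinj.exists_retraction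
  exact ⟨hT0, ApproachDistance.isCocomplete_of_retract hr hrs,
    ApproachDistance.isContinuous_of_retract hr hrs,
    ApproachDistance.eq_scottDistance_of_retract hr hrs⟩
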